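/- Let $\triangle_H=\{(z,w)\in\mathbb C^2: |z|<|w|<1\}$ be the Hartogs triangle and let $H^2(\triangle_H)$ be the Hilbert space of all holomorphic functions $f$ on $\triangle_H$ with $$\|f\|^2=\sup_{s,t\in(0,1)}\frac1{4\pi^2}\int_0^{2\pi}\!\!\int_0^{2\pi}\bigl|f(st\,e^{i\theta},t\,e^{i\gamma})\bigr|^2\,st^2\,d\theta\,d\gamma<\infty .$$ A submodule of $H^2(\triangle_H)$ is a closed subspace $\mathcal S$ that is invariant under the operators $M_z,M_w$ of multiplication by the coordinates; put $S_z=M_z|_{\mathcal S}$ and $S_w=M_w|_{\mathcal S}$. It is called doubly commuting if $S_z^*S_w=S_wS_z^*$ on $\mathcal S$. The rank of $\mathcal S$ is the least number of elements of a set $E\subseteq\mathcal S$ for which the closed linear span of $\{S_z^{k_1}S_w^{k_2}e: e\in E,\ k_1,k_2\ge 0\}$ is $\mathcal S$. **Corollary 2.5 (Rank).** Every doubly commuting submodule $\mathcal S\neq\{0\}$ of $H^2(\triangle_H)$ has rank $1$; that is, $\mathcal S$ is cyclic for $(S_z,S_w)$: there is $g\in\mathcal S$ such that $\mathcal S$ is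 the closed linear span of $\{S_z^{k_1}S_w^{k_2}g: k_1,k_2\ge 0\}$. -/

import Mathlib

open MeasureTheory Set

noncomputable section
namespace Hartogs

/-- The Hartogs triangle `△_H = {(z, w) | |z| < |w| < 1}`. -/
def hartogsTriangle : Set (ℂ × ℂ) := {p | ‖p.1‖ < ‖p.2‖ ∧ ‖p.2‖ < 1}

/-- `(1 / 4π²) ∫₀^{2π} ∫₀^{2π} |f(s t e^{iθ}, t e^{iγ})|² s t² dθ dγ`. -/
def hardyMean (f : ℂ × ℂ → ℂ) (s t : ℝ) : ℝ :=
  1 / (4 * Real.pi ^ 2) * ∫ θ in (0 : ℝ)..2 * Real.pi, ∫ γ in (0 : ℝ)..2 * Real.pi,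
    ‖f (s * t * Complex.exp (θ * Complex.I), t * Complex.exp (γ * Complex.I))‖ ^ 2 * (s * t ^ 2)

/-- All the values of `hardyMean f s t` for `s, t ∈ (0, 1)`. -/
def hardyMeans (f : ℂ × ℂ → ℂ) : Set ℝ :=
  {x | ∃ s ∈ Ioo (0 : ℝ) 1, ∃ t ∈ Ioo (0 : ℝ) 1, x = hardyMean f s t}

/-- The mean of `F` over the torus `|z| = ρ`, `|w| = t`. -/
def torusMean {E : Type*} [NormedAddCommGroup E] [NormedSpace ℝ E]
    (F : ℂ × ℂ → E) (ρ t : ℝ) : E :=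
  (1 / (4 * Real.pi ^ 2)) • ∫ θ in (0 : ℝ)..2 * Real.pi, ∫ γ in (0 : ℝ)..2 * Real.pi,
    F (ρ * Complex.exp (θ * Complex.I), t * Complex.exp (γ * Complex.I))

/-- The normalized Haar measure of the torus. -/
abbrev torusMeasure : Measure (UnitAddTorus (Fin 2)) := Measure.pi fun _ => AddCircle.haarAddCircle

/-- The parametrization of the torus `|z| = ρ`, `|w| = t`. -/
def torusPoint (ρ t : ℝ) (x : UnitAddTorus (Fin 2)) : ℂ × ℂ :=
  (ρ * (AddCircle.toCircle (x 0) : ℂ), t * (AddCircle.toCircle (x 1) : ℂ))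

theorem continuous_torusPoint (ρ t : ℝ) : Continuous (torusPoint ρ t) := by
  unfold torusPoint
  have := AddCircle.continuous_toCircle (T := 1)
  fun_prop

theorem integral_haar {E : Type*} [NormedAddCommGroup E] [NormedSpace ℝ E]
    (h : Circle → E) : ∫ x : UnitAddCircle, h (AddCircle.toCircle x) ∂AddCircle.haarAddCircle =
      (1 / (2 * Real.pi)) • ∫ θ in (0 : ℝ)..2 * Real.pi, h (Circle.exp θ) := by
  have h1 := UnitAddCircle.intervalIntegral_preimage 0 (fun x => h (AddCircle.toCircle x))
  have h2 : (volume : Measure UnitAddCircle) = AddCircle.haarAddCircle := by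
    rw [AddCircle.volume_eq_smul_haarAddCircle]; simp
  rw [h2] at h1
  rw [← h1]
  simp only [AddCircle.toCircle_apply_mk, div_one, zero_add]
  have := intervalIntegral.integral_comp_mul_left (a := 0) (b := 1) (fun θ => h (Circle.exp θ))
    (c := 2 * Real.pi) (by positivity)
  rw [this]; simp

theorem torusMean_eq {E : Type*} [NormedAddCommGroup E] [NormedSpace ℝ E] [CompleteSpace E]
    (F : ℂ × ℂ → E) (ρ t : ℝ) (hF : Continuous fun x => F (torusPoint ρ t x)) :
    torusMean F ρ t = ∫ x, F (torusPoint ρ t x) ∂torusMeasure := by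
  have h1 := (measurePreserving_finTwoArrow
    (AddCircle.haarAddCircle (T := 1))).symm.integral_comp' (fun x => F (torusPoint ρ t x))
  rw [← h1, integral_prod]
  · have e1 : ∀ c : ℂ, ∫ y : UnitAddCircle, F (ρ * c, t * (AddCircle.toCircle y : ℂ))
        ∂AddCircle.haarAddCircle = (1 / (2 * Real.pi)) • ∫ θ in (0 : ℝ)..2 * Real.pi,
          F (ρ * c, t * (Circle.exp θ : ℂ)) :=
      fun c => integral_haar (fun u : Circle => F (ρ * c, t * (u : ℂ)))
    have e2 := integral_haar (fun c : Circle => (1 / (2 * Real.pi)) •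
      ∫ θ in (0 : ℝ)..2 * Real.pi, F (ρ * (c : ℂ), t * (Circle.exp θ : ℂ)))
    refine Eq.trans ?_ (e2.symm.trans (integral_congr_ae (.of_forall fun x => (e1 _).symm)))
    rw [intervalIntegral.integral_smul, smul_smul]
    unfold torusMean
    simp only [Circle.coe_exp]
    congr 1
    field_simp; norm_num
  · apply Continuous.integrable_of_hasCompactSupport
    · apply hF.comp
      show Continuous (fun p : UnitAddCircle × UnitAddCircle => ![p.1, p.2])
      fun_prop
    · exact HasCompactSupport.of_compactSpace _

theorem torusMean_swap {E : Type*} [NormedAddCommGroup E] [NormedSpace ℝ E]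
    (F : ℂ × ℂ → E) (ρ t : ℝ) (hF : Continuous fun x => F (torusPoint ρ t x)) :
    torusMean F ρ t = (1 / (4 * Real.pi ^ 2)) • ∫ γ in (0 : ℝ)..2 * Real.pi,
      ∫ θ in (0 : ℝ)..2 * Real.pi,
    F (ρ * Complex.exp (θ * Complex.I), t * Complex.exp (γ * Complex.I)) := by
  unfold torusMean
  rw [intervalIntegral_intervalIntegral_swap]
  have : Continuous (Function.uncurry fun θ γ : ℝ =>
      F (ρ * Complex.exp (θ * Complex.I), t * Complex.exp (γ * Complex.I))) := by
    have h2 : Continuous fun p : ℝ × ℝ => ((![(↑(p.1 / (2 * Real.pi)) : UnitAddCircle),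
      ↑(p.2 / (2 * Real.pi))]) : UnitAddTorus (Fin 2)) := by
      have := AddCircle.continuous_mk' (1:ℝ)
      refine continuous_pi fun i => ?_
      fin_cases i
      · exact this.comp (by fun_prop)
      · exact this.comp (by fun_prop)
    refine (hF.comp h2).congr fun p => ?_
    have hp : (Real.pi : ℂ) ≠ 0 := by exact_mod_cast Real.pi_ne_zero
    have hx : ∀ x : ℝ, ((AddCircle.toCircle (↑(x / (2 * Real.pi)) : UnitAddCircle) : Circle) : ℂ)
        = Complex.exp (x * Complex.I) := by
      intro x
      rw [AddCircle.toCircle_apply_mk, Circle.coe_exp]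
      congr 2
      push_cast
      field_simp
    simp only [Function.comp_apply, Function.uncurry, torusPoint, Matrix.cons_val_zero,
      Matrix.cons_val_one, hx]
  exact (this.continuousOn.integrableOn_compact (isCompact_uIcc.prod isCompact_uIcc)).mono_set
    (prod_mono uIoc_subset_uIcc uIoc_subset_uIcc)



theorem isOpen_hartogsTriangle : IsOpen hartogsTriangle :=
  (isOpen_lt continuous_fst.norm continuous_snd.norm).inter
    (isOpen_lt continuous_snd.norm continuous_const)

theorem torusPoint_mem {ρ t : ℝ} (h0 : 0 < ρ) (h1 : ρ < t) (h2 : t < 1)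
    (x : UnitAddTorus (Fin 2)) : torusPoint ρ t x ∈ hartogsTriangle := by
  have : 0 < t := h0.trans h1
  have hc : ∀ c : Circle, ‖(c : ℂ)‖ = 1 := Circle.norm_coe
  simp only [torusPoint, hartogsTriangle, Set.mem_ofPred_eq, norm_mul, Complex.norm_real,
    Real.norm_eq_abs, abs_of_pos h0, abs_of_pos this, hc, mul_one]
  exact ⟨h1, h2⟩

theorem torusPoint_ne {ρ t : ℝ} (h0 : 0 < ρ) (h1 : ρ < t)
    (x : UnitAddTorus (Fin 2)) : (torusPoint ρ t x).1 ≠ 0 ∧ (torusPoint ρ t x).2 ≠ 0 := by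
  have : 0 < t := h0.trans h1
  simp [torusPoint, h0.ne', this.ne']

/-- The points of `△_H` with nonzero first coordinate. -/
def punctured : Set (ℂ × ℂ) := hartogsTriangle ∩ {p | p.1 ≠ 0}

theorem isOpen_punctured : IsOpen punctured :=
  isOpen_hartogsTriangle.inter (isOpen_ne_fun (by fun_prop) (by fun_prop))

theorem continuous_comp_torusPoint {E : Type*} [TopologicalSpace E] {G : ℂ × ℂ → E}
    (hG : ContinuousOn G punctured) {ρ t : ℝ} (h0 : 0 < ρ) (h1 : ρ < t) (h2 : t < 1) :
    Continuous fun x => G (torusPoint ρ t x) :=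
  hG.comp_continuous (continuous_torusPoint ρ t)
    fun x => ⟨torusPoint_mem h0 h1 h2 x, (torusPoint_ne h0 h1 x).1⟩

theorem integral_circle_indep {h : ℂ → ℂ} {r R : ℝ} (h0 : 0 < r) (hr : r ≤ R)
    (hd : ∀ z, r ≤ ‖z‖ → ‖z‖ ≤ R → DifferentiableAt ℂ h z) :
    ∫ θ in (0 : ℝ)..2 * Real.pi, h (R * Complex.exp (θ * Complex.I)) =
    ∫ θ in (0 : ℝ)..2 * Real.pi, h (r * Complex.exp (θ * Complex.I)) := by
  have key := Complex.circleIntegral_sub_center_inv_smul_eq_of_differentiable_on_annulus_off_countable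
    (c := 0) (f := h) h0 hr countable_empty
    (fun z hz => (hd z (by simpa using hz.2) (by simpa using hz.1)).continuousAt.continuousWithinAt)
    (fun z hz => hd z (by simpa using (not_le.1 (by simpa using hz.1.2)).le)
      (by simpa using (mem_ball_zero_iff.1 hz.1.1).le))
  have e : ∀ ρ : ℝ, 0 < ρ → (∮ z in C(0, ρ), (z - 0)⁻¹ • h z) =
      Complex.I * ∫ θ in (0 : ℝ)..2 * Real.pi, h (ρ * Complex.exp (θ * Complex.I)) := by
    intro ρ hρ
    rw [circleIntegral, ← intervalIntegral.integral_const_mul]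
    refine intervalIntegral.integral_congr fun θ _ => ?_
    have : (ρ : ℂ) ≠ 0 := by exact_mod_cast hρ.ne'
    have := Complex.exp_ne_zero (θ * Complex.I)
    simp [circleMap]
    field_simp
  rw [e _ h0, e _ (h0.trans_le hr)] at key
  exact mul_left_cancel₀ Complex.I_ne_zero key

theorem norm_mul_exp {r : ℝ} (h : 0 < r) (θ : ℝ) : ‖(r : ℂ) * Complex.exp (θ * Complex.I)‖ = r := by
  simp [Complex.norm_exp_ofReal_mul_I, abs_of_pos h]

theorem torusMean_indep_fst {G : ℂ × ℂ → ℂ} (hG : DifferentiableOn ℂ G punctured) {ρ ρ' t : ℝ}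
    (h0 : 0 < ρ) (h1 : ρ ≤ ρ') (h2 : ρ' < t) (h3 : t < 1) :
    torusMean G ρ' t = torusMean G ρ t := by
  have h0' := h0.trans_le h1
  have ht := h0'.trans h2
  rw [torusMean_swap, torusMean_swap]
  · congr 1
    refine intervalIntegral.integral_congr fun γ _ => ?_
    refine integral_circle_indep (h := fun z => G (z, t * Complex.exp (γ * Complex.I))) h0 h1 ?_
    intro z hz hz'
    have : DifferentiableAt ℂ G (z, t * Complex.exp (γ * Complex.I)) := by
      refine hG.differentiableAt (isOpen_punctured.mem_nhds ⟨⟨?_, ?_⟩, ?_⟩)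
      · simpa only [norm_mul_exp ht] using hz'.trans_lt h2
      · simpa only [norm_mul_exp ht]
      · exact norm_pos_iff.1 (h0.trans_le hz)
    exact this.comp z (f := fun z => (z, t * Complex.exp (γ * Complex.I))) (by fun_prop)
  · exact continuous_comp_torusPoint hG.continuousOn h0 (h1.trans_lt h2) h3
  · exact continuous_comp_torusPoint hG.continuousOn h0' h2 h3

theorem torusMean_indep_snd {G : ℂ × ℂ → ℂ} (hG : DifferentiableOn ℂ G punctured) {ρ t t' : ℝ}
    (h0 : 0 < ρ) (h1 : ρ < t) (h2 : t ≤ t') (h3 : t' < 1) :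
    torusMean G ρ t' = torusMean G ρ t := by
  unfold torusMean
  congr 1
  refine intervalIntegral.integral_congr fun θ _ => ?_
  refine integral_circle_indep (h := fun z => G (ρ * Complex.exp (θ * Complex.I), z))
    (h0.trans h1) h2 ?_
  intro z hz hz'
  have : DifferentiableAt ℂ G (ρ * Complex.exp (θ * Complex.I), z) := by
    refine hG.differentiableAt (isOpen_punctured.mem_nhds ⟨⟨?_, ?_⟩, ?_⟩)
    · simpa only [norm_mul_exp h0] using h1.trans_le hz
    · exact hz'.trans_lt h3
    · exact norm_pos_iff.1 (by simpa only [norm_mul_exp h0])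
  exact this.comp z (f := fun z => (ρ * Complex.exp (θ * Complex.I), z)) (by fun_prop)

theorem torusMean_indep {G : ℂ × ℂ → ℂ} (hG : DifferentiableOn ℂ G punctured) {ρ ρ' t t' : ℝ}
    (h0 : 0 < ρ) (h1 : ρ < t) (h2 : t < 1) (h0' : 0 < ρ') (h1' : ρ' < t') (h2' : t' < 1) :
    torusMean G ρ t = torusMean G ρ' t' := by
  have hm : max t t' < 1 := max_lt h2 h2'
  have hn : 0 < min ρ ρ' := lt_min h0 h0'
  rw [← torusMean_indep_snd hG h0 h1 (le_max_left t t') hm,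
    ← torusMean_indep_snd hG h0' h1' (le_max_right t t') hm,
    torusMean_indep_fst hG hn (min_le_left ρ ρ') (h1.trans_le (le_max_left _ _)) hm,
    torusMean_indep_fst hG hn (min_le_right ρ ρ') (h1'.trans_le (le_max_right _ _)) hm]

/-- The Laurent coefficient at `z^k w^l`, computed on the torus `|z| = ρ`, `|w| = t`. -/
def laurent (f : ℂ × ℂ → ℂ) (k l : ℤ) (ρ t : ℝ) : ℂ :=
  torusMean (fun p => p.1 ^ (-k) * p.2 ^ (-l) * f p) ρ t

theorem differentiableOn_laurent {f : ℂ × ℂ → ℂ} (hf : DifferentiableOn ℂ f hartogsTriangle)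
    (k l : ℤ) : DifferentiableOn ℂ (fun p : ℂ × ℂ => p.1 ^ k * p.2 ^ l * f p) punctured := by
  intro p hp
  have h2 : p.2 ≠ 0 := norm_pos_iff.1 ((norm_nonneg _).trans_lt hp.1.1)
  have h1 : p.1 ≠ 0 := hp.2
  have a1 : DifferentiableAt ℂ (fun p : ℂ × ℂ => p.1 ^ k) p :=
    (differentiableAt_zpow.2 (Or.inl h1)).comp p differentiableAt_fst
  have a2 : DifferentiableAt ℂ (fun p : ℂ × ℂ => p.2 ^ l) p :=
    (differentiableAt_zpow.2 (Or.inl h2)).comp p differentiableAt_snd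
  exact ((a1.mul a2).mul (hf.differentiableAt
    (isOpen_hartogsTriangle.mem_nhds hp.1))).differentiableWithinAt

theorem mFourierCoeff_eq {f : ℂ × ℂ → ℂ} (hf : ContinuousOn f hartogsTriangle) {ρ t : ℝ}
    (h0 : 0 < ρ) (h1 : ρ < t) (h2 : t < 1) (n : Fin 2 → ℤ) :
    UnitAddTorus.mFourierCoeff (fun x => f (torusPoint ρ t x)) n =
      ρ ^ (n 0) * t ^ (n 1) * laurent f (n 0) (n 1) ρ t := by
  have hρ : (ρ : ℂ) ≠ 0 := by exact_mod_cast h0.ne'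
  have ht : (t : ℂ) ≠ 0 := by exact_mod_cast (h0.trans h1).ne'
  unfold laurent
  rw [torusMean_eq, ← integral_const_mul]
  · change ∫ x, _ ∂torusMeasure = _
    refine integral_congr_ae (.of_forall fun x => ?_)
    simp only [UnitAddTorus.mFourier, ContinuousMap.coe_mk, Fin.prod_univ_two, torusPoint,
      fourier_apply, Pi.neg_apply, smul_eq_mul, mul_zpow, AddCircle.toCircle_zsmul,
      zpow_neg, Circle.coe_inv]
    rw [Circle.coe_zpow, Circle.coe_zpow]
    field_simp
  · refine continuous_comp_torusPoint
      (G := fun p : ℂ × ℂ => p.1 ^ (-n 0) * p.2 ^ (-n 1) * f p) (ContinuousOn.mul (ContinuousOn.mul ?_ ?_)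
      (hf.mono inter_subset_left)) h0 h1 h2
    · exact ContinuousOn.zpow₀ (by fun_prop) _ fun p hp => Or.inl hp.2
    · exact ContinuousOn.zpow₀ (by fun_prop) _ fun p hp =>
        Or.inl (norm_pos_iff.1 ((norm_nonneg _).trans_lt hp.1.1))

theorem hasSum_parseval {f : ℂ × ℂ → ℂ} (hf : ContinuousOn f hartogsTriangle) {ρ t : ℝ}
    (h0 : 0 < ρ) (h1 : ρ < t) (h2 : t < 1) :
    HasSum (fun n : Fin 2 → ℤ => ‖laurent f (n 0) (n 1) ρ t‖ ^ 2 * (ρ ^ (2 * n 0) * t ^ (2 * n 1)))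
      (torusMean (fun p => ‖f p‖ ^ 2) ρ t) := by
  have hc : Continuous fun x => f (torusPoint ρ t x) :=
    continuous_comp_torusPoint (hf.mono inter_subset_left) h0 h1 h2
  let g : C(UnitAddTorus (Fin 2), ℂ) := ⟨_, hc⟩
  have key := UnitAddTorus.hasSum_sq_mFourierCoeff (ContinuousMap.toLp 2 torusMeasure ℂ g)
  have e : ∀ n, UnitAddTorus.mFourierCoeff (ContinuousMap.toLp 2 torusMeasure ℂ g) n =
      UnitAddTorus.mFourierCoeff g n := UnitAddTorus.mFourierCoeff_toLp g
  simp only [e] at key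
  rw [torusMean_eq _ _ _ (hc.norm.pow 2)]
  convert key using 1
  · funext n
    have : UnitAddTorus.mFourierCoeff g n = _ := mFourierCoeff_eq hf h0 h1 h2 n
    rw [this]
    simp only [norm_mul, norm_zpow, Complex.norm_real, Real.norm_eq_abs, abs_of_pos h0,
      abs_of_pos (h0.trans h1)]
    rw [mul_comm 2 (n 0), mul_comm 2 (n 1), zpow_mul, zpow_mul, zpow_ofNat, zpow_ofNat]
    ring
  · refine integral_congr_ae ?_
    filter_upwards [ContinuousMap.coeFn_toLp (p := 2) (𝕜 := ℂ) torusMeasure g] with x hx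
    exact congrArg (fun z : ℂ => ‖z‖ ^ 2) hx.symm

theorem hardyMean_eq (f : ℂ × ℂ → ℂ) (s t : ℝ) :
    hardyMean f s t = torusMean (fun p => ‖f p‖ ^ 2) (s * t) t * (s * t ^ 2) := by
  simp only [hardyMean, torusMean, intervalIntegral.integral_mul_const, smul_eq_mul,
    Complex.ofReal_mul, mul_assoc]

theorem hardyMean_add_le {f g : ℂ × ℂ → ℂ} (hf : ContinuousOn f hartogsTriangle)
    (hg : ContinuousOn g hartogsTriangle) {s t : ℝ} (hs : s ∈ Ioo (0 : ℝ) 1)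
    (ht : t ∈ Ioo (0 : ℝ) 1) :
    hardyMean (f + g) s t ≤ 2 * (hardyMean f s t + hardyMean g s t) := by
  have h0 : 0 < s * t := mul_pos hs.1 ht.1
  have h1 : s * t < t := mul_lt_of_lt_one_left ht.1 hs.2
  have hc : ∀ f : ℂ × ℂ → ℂ, ContinuousOn f hartogsTriangle →
      Continuous fun x => ‖f (torusPoint (s * t) t x)‖ ^ 2 := fun f hf =>
    (continuous_comp_torusPoint (hf.mono inter_subset_left) h0 h1 ht.2).norm.pow 2
  have hi : ∀ f : ℂ × ℂ → ℂ, ContinuousOn f hartogsTriangle →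
      Integrable (fun x => ‖f (torusPoint (s * t) t x)‖ ^ 2) torusMeasure := fun f hf =>
    (hc f hf).integrable_of_hasCompactSupport (HasCompactSupport.of_compactSpace _)
  simp only [hardyMean_eq]
  rw [← add_mul, ← mul_assoc 2]
  refine mul_le_mul_of_nonneg_right ?_ (mul_nonneg hs.1.le (sq_nonneg t))
  rw [torusMean_eq _ _ _ (hc _ (hf.add hg)), torusMean_eq _ _ _ (hc _ hf),
    torusMean_eq _ _ _ (hc _ hg), ← integral_add (hi _ hf) (hi _ hg), ← integral_const_mul]
  refine integral_mono (hi _ (hf.add hg)) (((hi _ hf).add (hi _ hg)).const_mul 2) fun x => ?_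
  set a := f (torusPoint (s * t) t x)
  set b := g (torusPoint (s * t) t x)
  change ‖a + b‖ ^ 2 ≤ 2 * (‖a‖ ^ 2 + ‖b‖ ^ 2)
  nlinarith [norm_add_le a b, norm_nonneg (a + b), sq_nonneg (‖a‖ - ‖b‖), norm_nonneg a,
    norm_nonneg b]

theorem hardyMean_mul_le {f h : ℂ × ℂ → ℂ} (hf : ContinuousOn f hartogsTriangle)
    (hh : ContinuousOn h hartogsTriangle) (h1 : ∀ p ∈ hartogsTriangle, ‖h p‖ ≤ 1) {s t : ℝ}
    (hs : s ∈ Ioo (0 : ℝ) 1) (ht : t ∈ Ioo (0 : ℝ) 1) :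
    hardyMean (h * f) s t ≤ hardyMean f s t := by
  have h0 : 0 < s * t := mul_pos hs.1 ht.1
  have h2 : s * t < t := mul_lt_of_lt_one_left ht.1 hs.2
  have hc : ∀ f : ℂ × ℂ → ℂ, ContinuousOn f hartogsTriangle →
      Continuous fun x => ‖f (torusPoint (s * t) t x)‖ ^ 2 := fun f hf =>
    (continuous_comp_torusPoint (hf.mono inter_subset_left) h0 h2 ht.2).norm.pow 2
  have hi : ∀ f : ℂ × ℂ → ℂ, ContinuousOn f hartogsTriangle →
      Integrable (fun x => ‖f (torusPoint (s * t) t x)‖ ^ 2) torusMeasure := fun f hf =>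
    (hc f hf).integrable_of_hasCompactSupport (HasCompactSupport.of_compactSpace _)
  simp only [hardyMean_eq]
  refine mul_le_mul_of_nonneg_right ?_ (mul_nonneg hs.1.le (sq_nonneg t))
  rw [torusMean_eq _ _ _ (hc _ (hh.mul hf)), torusMean_eq _ _ _ (hc _ hf)]
  refine integral_mono (hi _ (hh.mul hf)) (hi _ hf) fun x => ?_
  have := h1 _ (torusPoint_mem h0 h2 ht.2 x)
  simp only [Pi.mul_apply, norm_mul]
  gcongr
  exact mul_le_of_le_one_left (norm_nonneg _) this

theorem hardyMean_smul (c : ℂ) (f : ℂ × ℂ → ℂ) (s t : ℝ) :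
    hardyMean (c • f) s t = ‖c‖ ^ 2 * hardyMean f s t := by
  simp only [hardyMean, Pi.smul_apply, smul_eq_mul, norm_mul, mul_pow, mul_assoc,
    intervalIntegral.integral_const_mul]
  ring

/-- The functions in `H²(△_H)`: the holomorphic functions on `△_H` whose means are bounded.  A
function on `△_H` is represented by its extension by zero to `ℂ × ℂ`, so that two elements are
equal if and only if they agree on `△_H`. -/
def hardyFunctions : Submodule ℂ (ℂ × ℂ → ℂ) where
  carrier := {f | DifferentiableOn ℂ f hartogsTriangle ∧ (∀ p ∉ hartogsTriangle, f p = 0) ∧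
    BddAbove (hardyMeans f)}
  zero_mem' := ⟨differentiableOn_const 0, fun _ _ => rfl, 0, by
    rintro _ ⟨s, -, t, -, rfl⟩
    simp [hardyMean]⟩
  add_mem' := by
    rintro f g ⟨hf, hf0, A, hA⟩ ⟨hg, hg0, B, hB⟩
    refine ⟨hf.add hg, fun p hp => by simp [hf0 p hp, hg0 p hp], 2 * (A + B), ?_⟩
    rintro _ ⟨s, hs, t, ht, rfl⟩
    have h1 := hA ⟨s, hs, t, ht, rfl⟩
    have h2 := hB ⟨s, hs, t, ht, rfl⟩
    have := hardyMean_add_le hf.continuousOn hg.continuousOn hs ht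
    linarith
  smul_mem' := by
    rintro c f ⟨hf, hf0, A, hA⟩
    refine ⟨hf.const_smul c, fun p hp => by simp [hf0 p hp], ‖c‖ ^ 2 * A, ?_⟩
    rintro _ ⟨s, hs, t, ht, rfl⟩
    rw [hardyMean_smul]
    exact mul_le_mul_of_nonneg_left (hA ⟨s, hs, t, ht, rfl⟩) (sq_nonneg _)

theorem laurent_eq {f : ℂ × ℂ → ℂ} (hf : DifferentiableOn ℂ f hartogsTriangle) (k l : ℤ)
    {ρ t ρ' t' : ℝ} (h0 : 0 < ρ) (h1 : ρ < t) (h2 : t < 1) (h0' : 0 < ρ') (h1' : ρ' < t')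
    (h2' : t' < 1) : laurent f k l ρ t = laurent f k l ρ' t' :=
  torusMean_indep (differentiableOn_laurent hf _ _) h0 h1 h2 h0' h1' h2'

/-- Laurent coefficients computed on a fixed torus. -/
def lc (f : ℂ × ℂ → ℂ) (n : Fin 2 → ℤ) : ℂ := laurent f (n 0) (n 1) (1 / 4) (1 / 2)

theorem hardyMean_hasSum_int {f : ℂ × ℂ → ℂ} (hf : DifferentiableOn ℂ f hartogsTriangle) {s t : ℝ}
    (hs : s ∈ Ioo (0 : ℝ) 1) (ht : t ∈ Ioo (0 : ℝ) 1) :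
    HasSum (fun n : Fin 2 → ℤ => ‖lc f n‖ ^ 2 * (s ^ (2 * n 0 + 1) * t ^ (2 * (n 0 + n 1 + 1))))
      (hardyMean f s t) := by
  have h0 : 0 < s * t := mul_pos hs.1 ht.1
  have h1 : s * t < t := mul_lt_of_lt_one_left ht.1 hs.2
  rw [hardyMean_eq]
  refine ((hasSum_parseval hf.continuousOn h0 h1 ht.2).mul_right (s * t ^ 2)).congr_fun fun n => ?_
  have e : lc f n = laurent f (n 0) (n 1) (s * t) t :=
    laurent_eq hf _ _ (by norm_num) (by norm_num) (by norm_num) h0 h1 ht.2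
  rw [e, mul_zpow, zpow_add_one₀ hs.1.ne', mul_add, mul_add, zpow_add₀ ht.1.ne', zpow_add₀ ht.1.ne', mul_one,
    zpow_ofNat]
  ring

theorem zpow_unbounded {c B : ℝ} (hc : 0 < c) {e : ℤ} (he : e < 0)
    (h : ∀ s ∈ Ioo (0 : ℝ) 1, c * s ^ e ≤ B) : False := by
  set s := c / (c + |B| + 1) with hs
  have hpos : 0 < c + |B| + 1 := by positivity
  have h0 : 0 < s := by positivity
  have h1 : s < 1 := (div_lt_one hpos).2 (by have := abs_nonneg B; linarith)
  have h2 := h s ⟨h0, h1⟩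
  have h3 : s ^ (-1 : ℤ) ≤ s ^ e := zpow_le_zpow_right_of_le_one₀ h0 h1.le (by lia)
  have h4 : c * s ^ (-1 : ℤ) = c + |B| + 1 := by
    rw [hs]; simp; field_simp
  have h5 := mul_le_mul_of_nonneg_left h3 hc.le
  have := le_abs_self B
  linarith

theorem lc_eq_zero {f : ℂ × ℂ → ℂ} (hf : f ∈ hardyFunctions) (n : Fin 2 → ℤ)
    (hn : n 0 < 0 ∨ n 0 + n 1 + 1 < 0) : lc f n = 0 := by
  obtain ⟨hd, -, B, hB⟩ := hf
  by_contra hne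
  have hpos : 0 < ‖lc f n‖ ^ 2 := by positivity
  have key : ∀ s ∈ Ioo (0 : ℝ) 1, ∀ t ∈ Ioo (0 : ℝ) 1,
      ‖lc f n‖ ^ 2 * (s ^ (2 * n 0 + 1) * t ^ (2 * (n 0 + n 1 + 1))) ≤ B := by
    intro s hs t ht
    refine le_trans ?_ (hB ⟨s, hs, t, ht, rfl⟩)
    refine le_hasSum (hardyMean_hasSum_int hd hs ht) n fun m _ => ?_
    have := hs.1
    have := ht.1
    positivity
  have hh : (1 / 2 : ℝ) ∈ Ioo (0 : ℝ) 1 := by norm_num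
  rcases hn with hn | hn
  · refine zpow_unbounded (c := ‖lc f n‖ ^ 2 * (1 / 2) ^ (2 * (n 0 + n 1 + 1))) (B := B)
      (by positivity) (e := 2 * n 0 + 1) (by lia) fun s hs => ?_
    refine le_trans (le_of_eq ?_) (key s hs _ hh)
    ring
  · refine zpow_unbounded (c := ‖lc f n‖ ^ 2 * (1 / 2) ^ (2 * n 0 + 1)) (B := B)
      (by positivity) (e := 2 * (n 0 + n 1 + 1)) (by lia) fun s hs => ?_
    refine le_trans (le_of_eq ?_) (key _ hh s hs)
    ring

/-- The exponents of `(1/w) (z/w)^m w^n = z^m w^(n-m-1)`. -/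
def idx (m : ℕ × ℕ) : Fin 2 → ℤ := ![m.1, m.2 - m.1 - 1]

theorem idx_injective : Function.Injective idx := by
  intro a b h
  have h0 := congrFun h 0
  have h1 := congrFun h 1
  simp [idx] at h0 h1
  ext <;> lia

/-- The coefficient of `f` at `(1/w) (z/w)^m w^n`. -/
def coeff (f : ℂ × ℂ → ℂ) (m : ℕ × ℕ) : ℂ := lc f (idx m)

theorem hardyMean_hasSum {f : ℂ × ℂ → ℂ} (hf : f ∈ hardyFunctions) {s t : ℝ}
    (hs : s ∈ Ioo (0 : ℝ) 1) (ht : t ∈ Ioo (0 : ℝ) 1) :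
    HasSum (fun m : ℕ × ℕ => ‖coeff f m‖ ^ 2 * (s ^ (2 * m.1 + 1) * t ^ (2 * m.2)))
      (hardyMean f s t) := by
  have := hardyMean_hasSum_int hf.1 hs ht
  rw [← idx_injective.hasSum_iff] at this
  · convert this using 2 with m
    have e1 : 2 * idx m 0 + 1 = ((2 * m.1 + 1 : ℕ) : ℤ) := by simp [idx]
    have e2 : 2 * (idx m 0 + idx m 1 + 1) = ((2 * m.2 : ℕ) : ℤ) := by
      simp [idx]; lia
    simp only [Function.comp_apply, e1, e2, zpow_natCast, coeff]
  · intro n hn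
    rw [lc_eq_zero hf n]
    · simp
    · by_contra! h
      refine hn ⟨((n 0).toNat, (n 0 + n 1 + 1).toNat), ?_⟩
      funext i
      fin_cases i <;> simp [idx] <;> lia

theorem sum_coeff_le {f : ℂ × ℂ → ℂ} (hf : f ∈ hardyFunctions) (F : Finset (ℕ × ℕ)) :
    ∑ m ∈ F, ‖coeff f m‖ ^ 2 ≤ sSup (hardyMeans f) := by
  have hlim : Filter.Tendsto (fun r : ℝ => ∑ m ∈ F, ‖coeff f m‖ ^ 2 *
      (r ^ (2 * m.1 + 1) * r ^ (2 * m.2))) (nhdsWithin 1 (Iio 1))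
      (nhds (∑ m ∈ F, ‖coeff f m‖ ^ 2 * (1 ^ (2 * m.1 + 1) * 1 ^ (2 * m.2)))) := by
    refine Filter.Tendsto.mono_left (Continuous.tendsto ?_ 1) nhdsWithin_le_nhds
    fun_prop
  simp only [one_pow, mul_one] at hlim
  refine le_of_tendsto hlim ?_
  filter_upwards [Ioo_mem_nhdsLT (zero_lt_one' ℝ)] with r hr
  refine le_trans ?_ (le_csSup hf.2.2 ⟨r, hr, r, hr, rfl⟩)
  have := hr.1
  exact sum_le_hasSum F (fun m _ => by positivity) (hardyMean_hasSum hf hr hr)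

theorem summable_coeff {f : ℂ × ℂ → ℂ} (hf : f ∈ hardyFunctions) :
    Summable fun m => ‖coeff f m‖ ^ 2 :=
  summable_of_sum_le (fun _ => by positivity) (sum_coeff_le hf)

theorem hardyMeans_nonempty (f : ℂ × ℂ → ℂ) : (hardyMeans f).Nonempty :=
  ⟨_, 1 / 2, by norm_num, 1 / 2, by norm_num, rfl⟩

theorem sSup_hardyMeans {f : ℂ × ℂ → ℂ} (hf : f ∈ hardyFunctions) :
    sSup (hardyMeans f) = ∑' m, ‖coeff f m‖ ^ 2 := by
  refine le_antisymm (csSup_le (hardyMeans_nonempty f) ?_) ?_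
  · rintro _ ⟨s, hs, t, ht, rfl⟩
    refine hasSum_le (fun m => ?_) (hardyMean_hasSum hf hs ht) (summable_coeff hf).hasSum
    have := hs.1
    have := ht.1
    refine mul_le_of_le_one_right (by positivity) (mul_le_one₀ ?_ (by positivity) ?_)
    · exact pow_le_one₀ hs.1.le hs.2.le
    · exact pow_le_one₀ ht.1.le ht.2.le
  · exact (summable_coeff hf).tsum_le_of_sum_le (sum_coeff_le hf)

theorem laurent_add {f g : ℂ × ℂ → ℂ} (hf : DifferentiableOn ℂ f hartogsTriangle)
    (hg : DifferentiableOn ℂ g hartogsTriangle) (n : Fin 2 → ℤ) :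
    lc (f + g) n = lc f n + lc g n := by
  have hc : ∀ {f : ℂ × ℂ → ℂ}, DifferentiableOn ℂ f hartogsTriangle → Continuous fun x =>
      (fun p : ℂ × ℂ => p.1 ^ (-n 0) * p.2 ^ (-n 1) * f p) (torusPoint (1 / 4) (1 / 2) x) :=
    fun hf => continuous_comp_torusPoint (differentiableOn_laurent hf (-n 0) (-n 1)).continuousOn
      (by norm_num) (by norm_num) (by norm_num)
  have hi := fun {f : ℂ × ℂ → ℂ} (hf : DifferentiableOn ℂ f hartogsTriangle) =>
    (hc hf).integrable_of_hasCompactSupport (μ := torusMeasure) (HasCompactSupport.of_compactSpace _)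
  unfold lc laurent
  rw [torusMean_eq _ _ _ (hc (hf.add hg)), torusMean_eq _ _ _ (hc hf), torusMean_eq _ _ _ (hc hg),
    ← integral_add (hi hf) (hi hg)]
  simp only [Pi.add_apply, mul_add]

theorem laurent_smul (c : ℂ) (f : ℂ × ℂ → ℂ) (n : Fin 2 → ℤ) : lc (c • f) n = c * lc f n := by
  unfold lc laurent torusMean
  simp only [Pi.smul_apply, smul_eq_mul, mul_left_comm _ c, intervalIntegral.integral_const_mul]
  rw [mul_smul_comm]

theorem eq_zero_of_coeff {f : ℂ × ℂ → ℂ} (hf : f ∈ hardyFunctions) (h : ∀ m, coeff f m = 0) :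
    f = 0 := by
  have hp : ∀ p ∈ punctured, f p = 0 := by
    rintro ⟨z, w⟩ ⟨⟨h1, h2⟩, h3⟩
    simp only at h1 h2
    have hz : 0 < ‖z‖ := norm_pos_iff.2 h3
    have hw : 0 < ‖w‖ := hz.trans h1
    have hs : ‖z‖ / ‖w‖ ∈ Ioo (0 : ℝ) 1 := ⟨by positivity, (div_lt_one hw).2 h1⟩
    have h0 := hardyMean_hasSum hf hs ⟨hw, h2⟩
    simp only [h, norm_zero, ne_eq, OfNat.ofNat_ne_zero, not_false_eq_true, zero_pow, zero_mul] at h0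
    have h4 := h0.unique hasSum_zero
    have hc : Continuous fun x => f (torusPoint ‖z‖ ‖w‖ x) :=
      continuous_comp_torusPoint (hf.1.continuousOn.mono inter_subset_left) hz h1 h2
    rw [hardyMean_eq, div_mul_cancel₀ _ hw.ne', torusMean_eq _ _ _ (hc.norm.pow 2)] at h4
    have h5 := (mul_eq_zero.1 h4).resolve_right (by positivity)
    rw [integral_eq_zero_iff_of_nonneg (fun x => sq_nonneg ‖f (torusPoint ‖z‖ ‖w‖ x)‖)
      ((hc.norm.pow 2).integrable_of_hasCompactSupport (HasCompactSupport.of_compactSpace _))] at h5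
    have h6 := (Continuous.ae_eq_iff_eq torusMeasure (hc.norm.pow 2) continuous_zero).1 h5
    have h7 := congrFun h6 ![↑(z.arg / (2 * Real.pi)), ↑(w.arg / (2 * Real.pi))]
    have hx : ∀ x : ℝ, ((AddCircle.toCircle (↑(x / (2 * Real.pi)) : UnitAddCircle) : Circle) : ℂ)
        = Complex.exp (x * Complex.I) := by
      intro x
      have hp : (Real.pi : ℂ) ≠ 0 := by exact_mod_cast Real.pi_ne_zero
      rw [AddCircle.toCircle_apply_mk, Circle.coe_exp]
      congr 2
      push_cast
      field_simp
    have h8 : torusPoint ‖z‖ ‖w‖ ![↑(z.arg / (2 * Real.pi)), ↑(w.arg / (2 * Real.pi))] = (z, w) := by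
      have e0 := hx z.arg
      have e1 := hx w.arg
      refine Prod.ext ?_ ?_
      · exact (congrArg _ e0).trans (Complex.norm_mul_exp_arg_mul_I z)
      · exact (congrArg _ e1).trans (Complex.norm_mul_exp_arg_mul_I w)
    change ‖f (torusPoint ‖z‖ ‖w‖ _)‖ ^ 2 = 0 at h7
    rw [h8] at h7
    simpa using h7
  funext ⟨z, w⟩
  by_cases hm : (z, w) ∈ hartogsTriangle
  swap
  · exact hf.2.1 _ hm
  by_cases hz : z = 0
  swap
  · exact hp _ ⟨hm, hz⟩
  subst hz
  have hc : ContinuousAt (fun z => f (z, w)) 0 :=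
    (hf.1.continuousOn.continuousAt (isOpen_hartogsTriangle.mem_nhds hm)).comp
      (f := fun z => (z, w)) (by fun_prop)
  have hU : {z | (z, w) ∈ hartogsTriangle} ∈ nhds (0 : ℂ) :=
    (isOpen_hartogsTriangle.preimage (by fun_prop : Continuous fun z : ℂ => (z, w))).mem_nhds hm
  refine tendsto_nhds_unique (hc.tendsto.mono_left nhdsWithin_le_nhds)
    (Filter.Tendsto.congr' ?_ (tendsto_const_nhds (f := nhdsWithin (0 : ℂ) {0}ᶜ)))
  filter_upwards [self_mem_nhdsWithin, nhdsWithin_le_nhds hU] with z h1 h2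
  exact (hp (z, w) ⟨h2, h1⟩).symm

/-- The Hardy space `H²(△_H)`, with the norm whose square is the supremum in its definition.  The
inner product is the one that induces this norm, given by polarization. -/
def HardySpace : Type := hardyFunctions

namespace HardySpace

instance : AddCommGroup HardySpace := inferInstanceAs (AddCommGroup hardyFunctions)
instance : Module ℂ HardySpace := inferInstanceAs (Module ℂ hardyFunctions)
instance : CoeFun HardySpace fun _ => ℂ × ℂ → ℂ := ⟨fun f => f.1⟩
instance : Norm HardySpace := ⟨fun f => √(sSup (hardyMeans f))⟩

theorem norm_def (f : HardySpace) : ‖f‖ = √(sSup (hardyMeans f)) := rfl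

theorem memℓp_coeff (f : HardySpace) : Memℓp (E := fun _ : ℕ × ℕ => ℂ) (coeff f) 2 :=
  memℓp_gen (by simpa using summable_coeff f.2)

/-- The coefficients with respect to the functions `(1/w) (z/w)^m w^n`, `m, n ≥ 0`. -/
def coeffs : HardySpace →ₗ[ℂ] lp (fun _ : ℕ × ℕ => ℂ) 2 where
  toFun f := ⟨coeff f, memℓp_coeff f⟩
  map_add' f g := by
    ext m
    exact laurent_add f.2.1 g.2.1 (idx m)
  map_smul' c f := by
    ext m
    exact laurent_smul c f (idx m)

theorem norm_coeffs (f : HardySpace) : ‖coeffs f‖ = ‖f‖ := by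
  rw [norm_def, sSup_hardyMeans f.2, lp.norm_eq_tsum_rpow (by norm_num)]
  simp [Real.sqrt_eq_rpow, coeffs]

theorem coeffs_injective : Function.Injective coeffs := by
  rw [injective_iff_map_eq_zero]
  intro f hf
  refine Subtype.ext (eq_zero_of_coeff f.2 fun m => ?_)
  exact congrFun (congrArg Subtype.val hf) m

theorem normedSpaceCore : NormedSpace.Core ℂ HardySpace where
  norm_nonneg f := Real.sqrt_nonneg _
  norm_smul c f := by rw [← norm_coeffs, map_smul, norm_smul, norm_coeffs]
  norm_triangle f g := by
    rw [← norm_coeffs, ← norm_coeffs, ← norm_coeffs, map_add]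
    exact norm_add_le _ _
  norm_eq_zero_iff f := by
    rw [← norm_coeffs, norm_eq_zero, map_eq_zero_iff _ coeffs_injective]

instance : NormedAddCommGroup HardySpace := NormedAddCommGroup.ofCore normedSpaceCore
instance : NormedSpace ℂ HardySpace := NormedSpace.ofCore normedSpaceCore
instance : InnerProductSpace ℂ HardySpace := InnerProductSpace.ofNorm ℂ fun f g => by
  have := parallelogram_law_with_norm ℂ (coeffs f) (coeffs g)
  rw [← map_add, ← map_sub, norm_coeffs, norm_coeffs, norm_coeffs, norm_coeffs] at this
  linarith

/-- `HardySpace.coeffs` as a linear isometry. -/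
def coeffsₗᵢ : HardySpace →ₗᵢ[ℂ] lp (fun _ : ℕ × ℕ => ℂ) 2 := ⟨coeffs, norm_coeffs⟩

end HardySpace

theorem differentiableOn_powerSeries {a : ℕ × ℕ → ℂ} {A : ℝ} (ha : ∀ m, ‖a m‖ ≤ A) :
    DifferentiableOn ℂ (fun p : ℂ × ℂ => ∑' m : ℕ × ℕ, a m * (p.1 ^ m.1 * p.2 ^ m.2))
      (Metric.ball 0 1) := by
  intro p hp
  rw [mem_ball_zero_iff] at hp
  obtain ⟨r, hpr, hr⟩ := exists_between hp
  have hr0 : 0 < r := (norm_nonneg p).trans_lt hpr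
  have hA : 0 ≤ A := (norm_nonneg _).trans (ha (0, 0))
  let f' : ℕ × ℕ → ℂ × ℂ → (ℂ × ℂ →L[ℂ] ℂ) := fun m x => a m •
    (x.1 ^ m.1 • ((m.2 * x.2 ^ (m.2 - 1)) • ContinuousLinearMap.snd ℂ ℂ ℂ) +
     x.2 ^ m.2 • ((m.1 * x.1 ^ (m.1 - 1)) • ContinuousLinearMap.fst ℂ ℂ ℂ))
  have s1 : Summable fun m : ℕ => r ^ m := summable_geometric_of_lt_one hr0.le hr
  have s2 : Summable fun m : ℕ => (m : ℝ) * r ^ (m - 1) := by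
    rw [← summable_nat_add_iff 1]
    simp only [Nat.cast_add, Nat.cast_one, add_tsub_cancel_right, add_mul, one_mul]
    refine Summable.add ?_ s1
    simpa using summable_pow_mul_geometric_of_norm_lt_one 1 (r := r) (by
      rwa [Real.norm_eq_abs, abs_of_pos hr0])
  have hu : Summable fun m : ℕ × ℕ => A * (r ^ m.1 * (m.2 * r ^ (m.2 - 1)) +
      (m.1 * r ^ (m.1 - 1)) * r ^ m.2) := by
    refine Summable.mul_left _ (Summable.add ?_ ?_)
    · exact s1.mul_of_nonneg s2 (fun _ => by positivity) (fun _ => by positivity)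
    · exact s2.mul_of_nonneg s1 (fun _ => by positivity) (fun _ => by positivity)
  have key := hasFDerivAt_tsum_of_isPreconnected (𝕜 := ℂ) (f' := f')
    (f := fun (m : ℕ × ℕ) (p : ℂ × ℂ) => a m * (p.1 ^ m.1 * p.2 ^ m.2)) hu
    (Metric.isOpen_ball (x := (0 : ℂ × ℂ)) (ε := r)) (convex_ball _ _).isPreconnected
    (fun m x _ => ?_) (fun m x hx => ?_) (Metric.mem_ball_self hr0) ?_ (mem_ball_zero_iff.2 hpr)
  · exact key.differentiableAt.differentiableWithinAt
  · have h1 : HasFDerivAt (fun x : ℂ × ℂ => x.1 ^ m.1) ((m.1 * x.1 ^ (m.1 - 1)) •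
      ContinuousLinearMap.fst ℂ ℂ ℂ) x :=
      (hasDerivAt_pow m.1 x.1).comp_hasFDerivAt x hasFDerivAt_fst
    have h2 : HasFDerivAt (fun x : ℂ × ℂ => x.2 ^ m.2) ((m.2 * x.2 ^ (m.2 - 1)) •
      ContinuousLinearMap.snd ℂ ℂ ℂ) x :=
      (hasDerivAt_pow m.2 x.2).comp_hasFDerivAt x hasFDerivAt_snd
    exact (h1.mul h2).const_mul (a m)
  · rw [mem_ball_zero_iff] at hx
    have hx1 : ‖x.1‖ ≤ r := (norm_fst_le x).trans hx.le
    have hx2 : ‖x.2‖ ≤ r := (norm_snd_le x).trans hx.le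
    have hf := ContinuousLinearMap.norm_fst_le ℂ ℂ ℂ
    have hs := ContinuousLinearMap.norm_snd_le ℂ ℂ ℂ
    simp only [f', norm_smul]
    refine mul_le_mul (ha m) ?_ (norm_nonneg _) hA
    refine (norm_add_le _ _).trans ?_
    simp only [norm_smul, norm_mul, norm_pow, Complex.norm_natCast]
    refine add_le_add ?_ ?_
    · calc _ ≤ r ^ m.1 * ((m.2 * r ^ (m.2 - 1)) * 1) := by gcongr
        _ = _ := by ring
    · calc _ ≤ r ^ m.2 * ((m.1 * r ^ (m.1 - 1)) * 1) := by gcongr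
        _ = _ := by ring
  · refine summable_of_ne_finset_zero (s := {(0, 0)}) fun m hm => ?_
    rcases m with ⟨_ | i, _ | j⟩ <;> simp at hm ⊢

open Classical in
/-- The function `∑ a_{m,n} (1/w) (z/w)^m w^n` on `△_H`, extended by zero. -/
def series (a : ℕ × ℕ → ℂ) (p : ℂ × ℂ) : ℂ :=
  if p ∈ hartogsTriangle then
    p.2⁻¹ * ∑' m : ℕ × ℕ, a m * ((p.1 / p.2) ^ m.1 * p.2 ^ m.2) else 0

theorem snd_ne_zero {p : ℂ × ℂ} (hp : p ∈ hartogsTriangle) : p.2 ≠ 0 :=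
  norm_pos_iff.1 ((norm_nonneg _).trans_lt hp.1)

theorem differentiableOn_series {a : ℕ × ℕ → ℂ} {A : ℝ} (ha : ∀ m, ‖a m‖ ≤ A) :
    DifferentiableOn ℂ (series a) hartogsTriangle := by
  have h1 : DifferentiableOn ℂ (fun p : ℂ × ℂ => (p.1 / p.2, p.2)) hartogsTriangle := fun p hp =>
    by
      have := (differentiableAt_snd (𝕜 := ℂ) (p := p)).fun_inv (snd_ne_zero hp)
      simp only [div_eq_mul_inv]
      exact ((differentiableAt_fst.fun_mul this).prodMk differentiableAt_snd).differentiableWithinAt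
  have h2 := (differentiableOn_powerSeries ha).comp h1 fun p hp => by
    rw [mem_ball_zero_iff, Prod.norm_def, max_lt_iff, norm_div]
    exact ⟨(div_lt_one (norm_pos_iff.2 (snd_ne_zero hp))).2 hp.1, hp.2⟩
  have h3 : DifferentiableOn ℂ (fun p : ℂ × ℂ => p.2⁻¹) hartogsTriangle := fun p hp =>
    (differentiableAt_snd.fun_inv (snd_ne_zero hp)).differentiableWithinAt
  exact (h3.mul h2).congr fun p hp => if_pos hp

theorem lc_series {a : ℕ × ℕ → ℂ} {A : ℝ} (ha : ∀ m, ‖a m‖ ≤ A) (n : Fin 2 → ℤ) :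
    HasSum (fun m => if idx m = n then a m else 0) (lc (series a) n) := by
  set ρ : ℝ := 1 / 4
  set t : ℝ := 1 / 2
  have h0 : 0 < ρ := by norm_num [ρ]
  have h1 : ρ < t := by norm_num [ρ, t]
  have h2 : t < 1 := by norm_num [t]
  have ht : 0 < t := h0.trans h1
  have hd := differentiableOn_series ha
  have hc : Continuous fun x => series a (torusPoint ρ t x) :=
    continuous_comp_torusPoint (hd.continuousOn.mono inter_subset_left) h0 h1 h2
  let g : C(UnitAddTorus (Fin 2), ℂ) := ⟨_, hc⟩
  let c : ℕ × ℕ → ℂ := fun m => a m * ((ρ : ℂ) ^ (idx m 0) * (t : ℂ) ^ (idx m 1))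
  have hA : 0 ≤ A := (norm_nonneg _).trans (ha (0, 0))
  have hcn : Summable fun m => ‖c m‖ := by
    have s1 : Summable fun m : ℕ => (1 / 2 : ℝ) ^ m := summable_geometric_two
    refine Summable.of_norm_bounded
      ((s1.mul_of_nonneg s1 (fun _ => by positivity) (fun _ => by positivity)).mul_left (A * 2))
      fun m => ?_
    rw [norm_norm, norm_mul, mul_assoc]
    refine mul_le_mul (ha m) (le_of_eq ?_) (norm_nonneg _) hA
    simp only [idx, Matrix.cons_val_zero, Matrix.cons_val_one, norm_mul, norm_zpow,
      Complex.norm_real, Real.norm_eq_abs, abs_of_pos h0, abs_of_pos ht]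
    rw [zpow_sub₀ ht.ne', zpow_sub₀ ht.ne', zpow_natCast, zpow_natCast, zpow_natCast, zpow_one]
    have : ρ = t * t := by norm_num [ρ, t]
    rw [this, mul_pow]
    simp only [t]
    field_simp
  have hcs : Summable fun m => c m • UnitAddTorus.mFourier (idx m) :=
    .of_norm (by simpa only [norm_smul, UnitAddTorus.mFourier_norm, mul_one] using hcn)
  have hg : HasSum (fun m => c m • UnitAddTorus.mFourier (idx m)) g := by
    convert hcs.hasSum
    ext x
    have e1 := ((ContinuousMap.evalCLM ℂ x).hasSum hcs.hasSum).tsum_eq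
    have hx := torusPoint_mem h0 h1 h2 x
    have hρ' : (ρ : ℂ) ≠ 0 := by exact_mod_cast h0.ne'
    have ht' : (t : ℂ) ≠ 0 := by exact_mod_cast ht.ne'
    refine Eq.trans ?_ e1
    change series a _ = _
    rw [series, if_pos hx, ← tsum_mul_left]
    refine tsum_congr fun m => ?_
    change _ = c m • UnitAddTorus.mFourier (idx m) x
    have u0 := Circle.coe_ne_zero (AddCircle.toCircle (x 0))
    have u1 := Circle.coe_ne_zero (AddCircle.toCircle (x 1))
    simp only [UnitAddTorus.mFourier, ContinuousMap.coe_mk, Fin.prod_univ_two, torusPoint,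
      fourier_apply, smul_eq_mul, AddCircle.toCircle_zsmul, c, idx, Matrix.cons_val_zero,
      Matrix.cons_val_one]
    rw [Circle.coe_zpow, Circle.coe_zpow, zpow_sub₀ ht', zpow_sub₀ ht', zpow_sub₀ u1, zpow_sub₀ u1]
    simp only [zpow_natCast, zpow_one, mul_pow, div_pow]
    field_simp
  have hδ : ∀ j : Fin 2 → ℤ, ∫ x, UnitAddTorus.mFourier (-n) x • UnitAddTorus.mFourier j x
      ∂torusMeasure = if j = n then 1 else 0 := by
    intro j
    have e1 := UnitAddTorus.mFourierBasis_repr (UnitAddTorus.mFourierBasis j) n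
    rw [HilbertBasis.repr_self, UnitAddTorus.coe_mFourierBasis] at e1
    have e2 := (UnitAddTorus.mFourierCoeff_toLp (UnitAddTorus.mFourier j) n).symm.trans e1.symm
    refine Eq.trans e2 ?_
    rw [lp.single_apply]
    simp [Pi.single_apply, eq_comm]
  have hI := hasSum_integral_of_summable_integral_norm (μ := torusMeasure)
    (F := fun m x => UnitAddTorus.mFourier (-n) x • c m • UnitAddTorus.mFourier (idx m) x)
    (fun m => (by fun_prop : Continuous fun x => UnitAddTorus.mFourier (-n) x • c m •
      UnitAddTorus.mFourier (idx m) x).integrable_of_hasCompactSupport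
        (HasCompactSupport.of_compactSpace _)) (by
    have hn : ∀ (j : Fin 2 → ℤ) x, ‖UnitAddTorus.mFourier j x‖ = 1 := fun j x => by
      simp only [UnitAddTorus.mFourier, ContinuousMap.coe_mk, Fin.prod_univ_two, fourier_apply,
        norm_mul]
      exact (congrArg₂ (· * ·) (Circle.norm_coe _) (Circle.norm_coe _)).trans (one_mul 1)
    simpa [norm_smul, hn] using hcn)
  have hI2 : ∫ x, ∑' m, UnitAddTorus.mFourier (-n) x • c m • UnitAddTorus.mFourier (idx m) x
      ∂torusMeasure = ρ ^ (n 0) * t ^ (n 1) * lc (series a) n := by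
    refine Eq.trans (integral_congr_ae (.of_forall fun x => ?_))
      (mFourierCoeff_eq hd.continuousOn h0 h1 h2 n)
    have e1 := ((ContinuousMap.evalCLM ℂ x).hasSum hg).tsum_eq
    simp only [smul_eq_mul]
    rw [tsum_mul_left]
    exact congrArg _ e1
  rw [hI2] at hI
  have hne : (ρ : ℂ) ^ (n 0) * (t : ℂ) ^ (n 1) ≠ 0 := mul_ne_zero
    (zpow_ne_zero _ (by exact_mod_cast h0.ne')) (zpow_ne_zero _ (by exact_mod_cast ht.ne'))
  have hJ := hI.mul_left ((ρ : ℂ) ^ (n 0) * (t : ℂ) ^ (n 1))⁻¹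
  rw [inv_mul_cancel_left₀ hne] at hJ
  refine hJ.congr_fun fun m => ?_
  simp only [smul_comm _ (c m), integral_smul, hδ]
  split_ifs with h
  · subst h
    simp only [c, smul_eq_mul]
    rw [mul_one, mul_comm (a m), inv_mul_cancel_left₀ hne]
  · simp

theorem coeff_series_idx {a : ℕ × ℕ → ℂ} {A : ℝ} (ha : ∀ m, ‖a m‖ ≤ A) (m : ℕ × ℕ) :
    coeff (series a) m = a m := by
  refine (lc_series ha (idx m)).unique ?_
  simpa using hasSum_single (f := fun m' => if idx m' = idx m then a m' else 0) m
    fun m' hm => if_neg fun h => hm (idx_injective h)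

theorem series_mem {a : ℕ × ℕ → ℂ} (ha : Summable fun m => ‖a m‖ ^ 2) :
    series a ∈ hardyFunctions := by
  have hb : ∀ m, ‖a m‖ ≤ √(∑' m, ‖a m‖ ^ 2) := fun m =>
    Real.le_sqrt_of_sq_le (ha.le_tsum m fun _ _ => by positivity)
  refine ⟨differentiableOn_series hb, fun p hp => if_neg hp, ∑' m, ‖a m‖ ^ 2, ?_⟩
  rintro _ ⟨s, hs, t, ht, rfl⟩
  have h := hardyMean_hasSum_int (differentiableOn_series hb) hs ht
  rw [← idx_injective.hasSum_iff] at h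
  · refine hasSum_le (fun m => ?_) h ha.hasSum
    have e1 : 2 * idx m 0 + 1 = ((2 * m.1 + 1 : ℕ) : ℤ) := by simp [idx]
    have e2 : 2 * (idx m 0 + idx m 1 + 1) = ((2 * m.2 : ℕ) : ℤ) := by
      simp [idx]; lia
    have e3 : lc (series a) (idx m) = a m := coeff_series_idx hb m
    simp only [Function.comp_apply, e1, e2, zpow_natCast, e3]
    have := hs.1
    have := ht.1
    refine mul_le_of_le_one_right (by positivity) (mul_le_one₀ ?_ (by positivity) ?_)
    · exact pow_le_one₀ hs.1.le hs.2.le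
    · exact pow_le_one₀ ht.1.le ht.2.le
  · intro n hn
    have : lc (series a) n = 0 := (lc_series hb n).unique (by
      convert hasSum_zero with m
      exact if_neg fun h => hn ⟨m, h⟩)
    simp [this]

namespace HardySpace

theorem coeffs_surjective : Function.Surjective coeffs := by
  intro a
  have ha : Summable fun m => ‖a m‖ ^ 2 := by
    simpa using (lp.memℓp a).summable (by norm_num)
  refine ⟨⟨series a, series_mem ha⟩, ?_⟩
  ext m
  exact coeff_series_idx (lp.norm_apply_le_norm (by norm_num) a) m

/-- `H²(△_H)` is isometrically isomorphic to `ℓ²(ℕ × ℕ)`. -/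
def coeffsEquiv : HardySpace ≃ₗᵢ[ℂ] lp (fun _ : ℕ × ℕ => ℂ) 2 :=
  LinearIsometryEquiv.ofSurjective coeffsₗᵢ coeffs_surjective

instance : CompleteSpace HardySpace :=
  coeffsEquiv.toIsometryEquiv.completeSpace

theorem mul_mem {h : ℂ × ℂ → ℂ} (hd : Differentiable ℂ h)
    (h1 : ∀ p ∈ hartogsTriangle, ‖h p‖ ≤ 1) (f : HardySpace) :
    h * f.1 ∈ hardyFunctions ∧ sSup (hardyMeans (h * f.1)) ≤ sSup (hardyMeans f.1) := by
  have key : ∀ x ∈ hardyMeans (h * f.1), x ≤ sSup (hardyMeans f.1) := by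
    rintro _ ⟨s, hs, t, ht, rfl⟩
    exact (hardyMean_mul_le f.2.1.continuousOn hd.continuous.continuousOn h1 hs ht).trans
      (le_csSup f.2.2.2 ⟨s, hs, t, ht, rfl⟩)
  refine ⟨⟨hd.differentiableOn.mul f.2.1, fun p hp => ?_, _, key⟩,
    csSup_le (hardyMeans_nonempty _) key⟩
  simp [f.2.2.1 p hp]

/-- Multiplication by an entire function `h` with `|h| ≤ 1` on `△_H`. -/
def mulOp (h : ℂ × ℂ → ℂ) (hd : Differentiable ℂ h)
    (h1 : ∀ p ∈ hartogsTriangle, ‖h p‖ ≤ 1) : HardySpace →L[ℂ] HardySpace :=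
  LinearMap.mkContinuous
    { toFun := fun f => ⟨h * f.1, (mul_mem hd h1 f).1⟩
      map_add' := fun f g => Subtype.ext (mul_add h f.1 g.1)
      map_smul' := fun c f => Subtype.ext (mul_smul_comm c h f.1) } 1
    fun f => by
      rw [one_mul]
      exact Real.sqrt_le_sqrt (mul_mem hd h1 f).2

/-- `M_z`, multiplication by the first coordinate. -/
def Mz : HardySpace →L[ℂ] HardySpace :=
  mulOp Prod.fst differentiable_fst fun _ hp => (hp.1.trans hp.2).le

/-- `M_w`, multiplication by the second coordinate. -/
def Mw : HardySpace →L[ℂ] HardySpace :=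
  mulOp Prod.snd differentiable_snd fun _ hp => hp.2.le

theorem Mz_apply (f : HardySpace) (p : ℂ × ℂ) : Mz f p = p.1 * f p := rfl

theorem Mw_apply (f : HardySpace) (p : ℂ × ℂ) : Mw f p = p.2 * f p := rfl

end HardySpace

/-- The closed linear span `[E]_T` of `{T₁ ^ k₁ T₂ ^ k₂ e | e ∈ E, k₁, k₂ ≥ 0}`. -/
def closedSpan {H : Type*} [NormedAddCommGroup H] [InnerProductSpace ℂ H]
    (T₁ T₂ : H →L[ℂ] H) (E : Set H) : Submodule ℂ H :=
  (Submodule.span ℂ {x | ∃ k₁ k₂ : ℕ, ∃ e ∈ E, x = (T₁ ^ k₁) ((T₂ ^ k₂) e)}).topologicalClosure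

/-- The rank of a pair of operators: the least number of elements of a set `E` with `[E]_T = H`
(`⊤ : ℕ∞` if there is no finite such set; the set of cardinalities below is never empty, since
`E = H` is admissible, and the infimum in `ℕ∞` is a minimum). -/
def rank {H : Type*} [NormedAddCommGroup H] [InnerProductSpace ℂ H] (T₁ T₂ : H →L[ℂ] H) : ℕ∞ :=
  sInf {n | ∃ E : Set H, closedSpan T₁ T₂ E = ⊤ ∧ E.encard = n}

/-- A submodule of the Hilbert module `H²(△_H)` over `ℂ[z, w]`: a closed linear subspace invariant
under multiplication by `z` and by `w`. -/
structure HardySubmodule where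
  /-- the underlying linear subspace -/
  carrier : Submodule ℂ HardySpace
  isClosed : IsClosed (carrier : Set HardySpace)
  Mz_mem : ∀ f ∈ carrier, HardySpace.Mz f ∈ carrier
  Mw_mem : ∀ f ∈ carrier, HardySpace.Mw f ∈ carrier

namespace HardySubmodule

instance (S : HardySubmodule) : CompleteSpace S.carrier := S.isClosed.completeSpace_coe

/-- `S_z`, the restriction of `M_z` to `S`. -/
def Sz (S : HardySubmodule) : S.carrier →L[ℂ] S.carrier := HardySpace.Mz.restrict S.Mz_mem

/-- `S_w`, the restriction of `M_w` to `S`. -/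
def Sw (S : HardySubmodule) : S.carrier →L[ℂ] S.carrier := HardySpace.Mw.restrict S.Mw_mem

/-- `S` is doubly commuting if `S_z^* S_w - S_w S_z^* = 0`; the adjoint is taken in the Hilbert
space `S`. -/
def DoublyCommuting (S : HardySubmodule) : Prop :=
  (ContinuousLinearMap.adjoint S.Sz).comp S.Sw - S.Sw.comp (ContinuousLinearMap.adjoint S.Sz) = 0

end HardySubmodule

end Hartogs

end

/-!
`S_z` and `S_w` are pure isometries, and by double commutativity `ker S_z*` reduces `S_w`. Applying
the Wold decomposition first to `S_z` and then to `S_w` on `ker S_z*` shows that the wandering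
subspace `W = ker S_z* ∩ ker S_w*` generates `S`, so it is enough that `dim W ≤ 1`.

In the orthogonal basis `w⁻¹ (z/w)^m w^n` the space `H²(△_H)` becomes `ℓ²(ℕ²)`, with `M_z` and `M_w`
the translations by `(1, 1)` and `(0, 1)`. For `f, g ∈ W` distinct translates are orthogonal: after
multiplication by a power of `w` this is the orthogonality of the spaces `S_z^i S_w^j W`. Suppose
`f, g ∈ W` are orthogonal unit vectors. Convolution by `f` maps `ℓ²` isometrically onto the closed
span of the translates of `f`, and likewise for `g`. These two spans are orthogonal, yet both
contain `f * g = g * f`; hence `f * g = 0`, contradicting the isometry.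
-/

namespace Hartogs

open ContinuousLinearMap
open scoped InnerProductSpace lp

section Wold

variable {𝕜 H : Type*} [RCLike 𝕜] [NormedAddCommGroup H] [InnerProductSpace 𝕜 H] [CompleteSpace H]
  {A B : H →L[𝕜] H}

/-- An operator is pure if the ranges of its powers intersect in `0`. For an isometry this says
that the unitary part of its Wold decomposition vanishes. -/
def IsPure (A : H →L[𝕜] H) : Prop :=
  ∀ x, (∀ n : ℕ, x ∈ range (A ^ n)) → x = 0

/-- The defect operator `1 - A A*`. For an isometry `A` it is the orthogonal projection onto the
wandering subspace `ker A*`. -/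
noncomputable def defect (A : H →L[𝕜] H) : H →L[𝕜] H := 1 - A * star A

theorem defect_apply (A : H →L[𝕜] H) (x : H) : defect A x = x - A (star A x) := rfl

theorem inner_defect_left (A : H →L[𝕜] H) (x y : H) :
    ⟪defect A x, y⟫_𝕜 = ⟪x, defect A y⟫_𝕜 := by
  have hstar : star (defect A) = defect A := by simp [defect]
  rw [← adjoint_inner_right, ← star_eq_adjoint, hstar]

theorem defect_apply_of_star_apply_eq_zero {x : H} (hx : star A x = 0) : defect A x = x := by
  rw [defect_apply, hx, map_zero, sub_zero]

theorem star_apply_defect_apply (hA : star A * A = 1) (x : H) : star A (defect A x) = 0 := by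
  rw [defect_apply, map_sub, ← mul_apply_eq_comp (star A) A, hA, one_apply_eq_self, sub_self]

theorem commute_defect (hAB : Commute A B) (hAB' : Commute (star A) B) : Commute (defect A) B :=
  (Commute.one_left B).sub_left (hAB.mul_left hAB')

theorem inner_pow_apply_pow_apply (hA : star A * A = 1) (n : ℕ) (x y : H) :
    ⟪(A ^ n) x, (A ^ n) y⟫_𝕜 = ⟪x, y⟫_𝕜 := by
  induction n with
  | zero => rfl
  | succ n ih =>
    rw [pow_succ', mul_apply_eq_comp, mul_apply_eq_comp,
      A.inner_map_map_iff_adjoint_comp_self.2 hA, ih]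

theorem inner_pow_apply_pow_apply_eq_zero_of_lt (hA : star A * A = 1) {v : H} (hv : star A v = 0)
    {m n : ℕ} (hmn : m < n) (x : H) : ⟪(A ^ n) x, (A ^ m) v⟫_𝕜 = 0 := by
  obtain ⟨d, rfl⟩ := Nat.exists_eq_add_of_lt hmn
  rw [add_assoc, pow_add, mul_apply_eq_comp, inner_pow_apply_pow_apply hA, pow_succ',
    mul_apply_eq_comp, ← adjoint_inner_right, ← star_eq_adjoint, hv, inner_zero_right]

theorem inner_pow_apply_left (A : H →L[𝕜] H) (n : ℕ) (x y : H) :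
    ⟪(A ^ n) x, y⟫_𝕜 = ⟪x, (star A ^ n) y⟫_𝕜 := by
  rw [← adjoint_inner_right, ← star_eq_adjoint, star_pow]

theorem IsPure.eq_zero_of_inner_pow_apply (hpure : IsPure A) (hA : star A * A = 1) {x : H}
    (hx : ∀ (n : ℕ) (v : H), star A v = 0 → ⟪(A ^ n) v, x⟫_𝕜 = 0) : x = 0 := by
  have hdefect (n : ℕ) : defect A ((star A ^ n) x) = 0 := by
    set v := defect A ((star A ^ n) x) with hv
    have hv_ker : star A v = 0 := star_apply_defect_apply hA _
    rw [← inner_self_eq_zero (𝕜 := 𝕜)]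
    calc ⟪v, v⟫_𝕜 = ⟪v, (star A ^ n) x⟫_𝕜 := by
          rw [hv, ← inner_defect_left, ← hv, defect_apply_of_star_apply_eq_zero hv_ker]
      _ = 0 := by rw [← inner_pow_apply_left, hx n v hv_ker]
  refine hpure x fun n => ⟨(star A ^ n) x, ?_⟩
  induction n with
  | zero => rfl
  | succ n ih =>
    have hfix : (star A ^ n) x = A (star A ((star A ^ n) x)) := sub_eq_zero.1 (hdefect n)
    rw [pow_succ, pow_succ', mul_apply_eq_comp, mul_apply_eq_comp, ← hfix, ih]

/-- A pair of commuting isometries, the adjoint of each of which commutes with the other. -/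
structure DoublyCommutingIsometries (A B : H →L[𝕜] H) : Prop where
  isometry_left : star A * A = 1
  isometry_right : star B * B = 1
  commute : Commute A B
  commute_star : Commute (star A) B

/-- The wandering subspace `ker A* ∩ ker B*` of a pair of isometries, that is, the orthogonal
complement of `range A + range B`. -/
noncomputable def wanderingSubspace (A B : H →L[𝕜] H) : Submodule 𝕜 H :=
  (star A).ker ⊓ (star B).ker

namespace DoublyCommutingIsometries

theorem symm (h : DoublyCommutingIsometries A B) : DoublyCommutingIsometries B A where
  isometry_left := h.isometry_right
  isometry_right := h.isometry_left
  commute := h.commute.symm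
  commute_star := by simpa using h.commute_star.symm.star_star

theorem star_apply_pow_apply_eq_zero (h : DoublyCommutingIsometries A B) {v : H}
    (hv : star A v = 0) (j : ℕ) : star A ((B ^ j) v) = 0 := by
  rw [← mul_apply_eq_comp, (h.commute_star.pow_right j).eq, mul_apply_eq_comp, hv, map_zero]

theorem defect_apply_mem_wanderingSubspace (h : DoublyCommutingIsometries A B) {v : H}
    (hv : star B v = 0) : defect A v ∈ wanderingSubspace A B := by
  have hcomm : Commute (defect A) (star B) :=
    commute_defect h.symm.commute_star.symm h.commute.star_star
  refine ⟨star_apply_defect_apply h.isometry_left v, ?_⟩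
  change star B (defect A v) = 0
  rw [← mul_apply_eq_comp, ← hcomm.eq, mul_apply_eq_comp, hv, map_zero]

theorem inner_pow_pow_apply_eq_zero (h : DoublyCommutingIsometries A B) {f g : H}
    (hf : f ∈ wanderingSubspace A B) (hg : g ∈ wanderingSubspace A B) {i j k l : ℕ}
    (hne : (i, j) ≠ (k, l)) : ⟪(A ^ i) ((B ^ j) f), (A ^ k) ((B ^ l) g)⟫_𝕜 = 0 := by
  rcases lt_trichotomy i k with hik | rfl | hki
  · exact inner_eq_zero_symm.1 <| inner_pow_apply_pow_apply_eq_zero_of_lt h.isometry_left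
      (h.star_apply_pow_apply_eq_zero hf.1 j) hik _
  · rw [inner_pow_apply_pow_apply h.isometry_left]
    rcases lt_or_gt_of_ne (show j ≠ l from fun hjl => hne (by rw [hjl])) with hjl | hlj
    · exact inner_eq_zero_symm.1 <|
        inner_pow_apply_pow_apply_eq_zero_of_lt h.isometry_right hf.2 hjl _
    · exact inner_pow_apply_pow_apply_eq_zero_of_lt h.isometry_right hg.2 hlj _
  · exact inner_pow_apply_pow_apply_eq_zero_of_lt h.isometry_left
      (h.star_apply_pow_apply_eq_zero hg.1 l) hki _

theorem eq_zero_of_inner_wandering (h : DoublyCommutingIsometries A B) (hA : IsPure A)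
    (hB : IsPure B) {x : H}
    (hx : ∀ i j : ℕ, ∀ v ∈ wanderingSubspace A B, ⟪(A ^ i) ((B ^ j) v), x⟫_𝕜 = 0) : x = 0 := by
  refine hA.eq_zero_of_inner_pow_apply h.isometry_left fun i u hu => ?_
  -- `ker A*` reduces `B`, so the one-operator case applies to `B` and the projection of `A*ⁱ x`
  -- onto `ker A*`.
  have hdefect : defect A ((star A ^ i) x) = 0 := by
    refine hB.eq_zero_of_inner_pow_apply h.isometry_right fun j v hv => ?_
    have hcomm : Commute (defect A) (B ^ j) :=
      (commute_defect h.commute h.commute_star).pow_right j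
    rw [← inner_defect_left, ← mul_apply_eq_comp, hcomm.eq, mul_apply_eq_comp,
      ← inner_pow_apply_left]
    exact hx i j _ (h.defect_apply_mem_wanderingSubspace hv)
  rw [inner_pow_apply_left, ← defect_apply_of_star_apply_eq_zero hu, inner_defect_left, hdefect,
    inner_zero_right]

theorem closedSpan_eq_top {H : Type*} [NormedAddCommGroup H] [InnerProductSpace ℂ H]
    [CompleteSpace H] {A B : H →L[ℂ] H} (h : DoublyCommutingIsometries A B) (hA : IsPure A)
    (hB : IsPure B) {E : Set H} (hE : wanderingSubspace A B ≤ Submodule.span ℂ E) :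
    closedSpan A B E = ⊤ := by
  rw [closedSpan, Submodule.topologicalClosure_eq_top_iff, Submodule.eq_bot_iff]
  refine fun x hx => h.eq_zero_of_inner_wandering hA hB fun i j v hv => ?_
  have hle : Submodule.span ℂ E ≤ (Submodule.span ℂ
      {y | ∃ k₁ k₂ : ℕ, ∃ e ∈ E, y = (A ^ k₁) ((B ^ k₂) e)}).comap (A ^ i * B ^ j).toLinearMap :=
    Submodule.span_le.2 fun e he => Submodule.subset_span ⟨i, j, e, he, rfl⟩
  exact hx _ (hle (hE hv))

end DoublyCommutingIsometries

end Wold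

theorem exists_le_span_singleton_of_inner_eq_zero {𝕜 E : Type*} [RCLike 𝕜] [NormedAddCommGroup E]
    [InnerProductSpace 𝕜 E] {K : Submodule 𝕜 E}
    (hK : ∀ f ∈ K, ∀ g ∈ K, ⟪f, g⟫_𝕜 = 0 → f = 0 ∨ g = 0) : ∃ g, K ≤ 𝕜 ∙ g := by
  obtain rfl | hbot := eq_or_ne K ⊥
  · exact ⟨0, bot_le⟩
  obtain ⟨g, hgK, hg⟩ := K.exists_mem_ne_zero_of_ne_bot hbot
  refine ⟨g, fun v hv => ?_⟩
  have hproj := (𝕜 ∙ g).starProjection_apply_mem v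
  have horth : ⟪g, v - (𝕜 ∙ g).starProjection v⟫_𝕜 = 0 :=
    (𝕜 ∙ g).sub_starProjection_mem_orthogonal v g (Submodule.mem_span_singleton_self g)
  have hv_eq := (hK g hgK _ (K.sub_mem hv
    ((Submodule.span_singleton_le_iff_mem g K).2 hgK hproj)) horth).resolve_left hg
  rwa [sub_eq_zero.1 hv_eq]

theorem rank_eq_one {H : Type*} [NormedAddCommGroup H] [InnerProductSpace ℂ H] [Nontrivial H]
    {T₁ T₂ : H →L[ℂ] H} {g : H} (hg : closedSpan T₁ T₂ {g} = ⊤) : rank T₁ T₂ = 1 := by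
  refine le_antisymm (sInf_le ⟨{g}, hg, encard_singleton g⟩) (le_sInf ?_)
  rintro _ ⟨E, hE, rfl⟩
  rw [one_le_encard_iff_nonempty, nonempty_iff_ne_empty]
  rintro rfl
  simp [closedSpan] at hE

section Translate

variable {ι 𝕜 : Type*} [RCLike 𝕜]

theorem memℓp_extend {α β : Type*} (e : α ↪ β) (f : ℓ²(α, 𝕜)) :
    Memℓp (E := fun _ : β => 𝕜) (Function.extend e f 0) 2 := by
  refine memℓp_gen ((e.injective.summable_iff fun b hb => ?_).1 ?_)
  · simp [Function.extend_apply' _ _ _ hb]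
  · simpa [Function.comp_def, e.injective.extend_apply] using (lp.memℓp f).summable (by norm_num)

/-- The isometry of `ℓ²` spaces induced by an injection of index sets: extension by zero. -/
noncomputable def extendₗᵢ {α β : Type*} (e : α ↪ β) : ℓ²(α, 𝕜) →ₗᵢ[𝕜] ℓ²(β, 𝕜) where
  toFun f := ⟨Function.extend e f 0, memℓp_extend e f⟩
  map_add' f g := lp.ext <| by
    have hadd := Function.extend_add e f g 0 0
    rw [add_zero] at hadd
    exact hadd
  map_smul' c f := lp.ext <| by
    have hsmul := Function.extend_smul c e f 0
    rw [smul_zero] at hsmul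
    exact hsmul
  norm_map' f := by
    have hzero : ∀ b ∉ range e, ‖Function.extend e f 0 b‖ ^ (2 : ENNReal).toReal = 0 := by
      intro b hb
      simp [Function.extend_apply' _ _ _ hb]
    have htsum := e.injective.tsum_eq (Function.support_subset_iff'.2 hzero)
    simp only [e.injective.extend_apply] at htsum
    rw [lp.norm_eq_tsum_rpow (by norm_num), lp.norm_eq_tsum_rpow (by norm_num), htsum]
    rfl

variable [AddCancelCommMonoid ι]

/-- Translation by `n` on `ℓ²(ι)`: the `k`-th entry moves to position `k + n`, and the entries
outside `ι + n` are `0`. -/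
noncomputable def translate (n : ι) : ℓ²(ι, 𝕜) →ₗᵢ[𝕜] ℓ²(ι, 𝕜) := extendₗᵢ (addRightEmbedding n)

theorem translate_apply_add (n k : ι) (f : ℓ²(ι, 𝕜)) : translate n f (k + n) = f k :=
  (addRightEmbedding n).injective.extend_apply f 0 k

theorem translate_apply_of_notMem_range {n k : ι} (hk : k ∉ range (· + n)) (f : ℓ²(ι, 𝕜)) :
    translate n f k = 0 :=
  Function.extend_apply' (f := addRightEmbedding n) f 0 k hk

theorem eq_translate {n : ι} {f h : ℓ²(ι, 𝕜)} (hadd : ∀ k, h (k + n) = f k)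
    (hzero : ∀ k ∉ range (· + n), h k = 0) : h = translate n f := by
  ext k
  by_cases hk : k ∈ range (· + n)
  · obtain ⟨k, rfl⟩ := hk
    exact (hadd k).trans (translate_apply_add n k f).symm
  · rw [hzero k hk, translate_apply_of_notMem_range hk]

theorem translate_translate (n m : ι) (f : ℓ²(ι, 𝕜)) :
    translate n (translate m f) = translate (m + n) f := by
  refine eq_translate (fun k => ?_) fun k hk => ?_
  · rw [← add_assoc, translate_apply_add, translate_apply_add]
  · by_cases hkn : k ∈ range (· + n)
    · obtain ⟨k, rfl⟩ := hkn
      rw [translate_apply_add, translate_apply_of_notMem_range]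
      rintro ⟨l, rfl⟩
      exact hk ⟨l, (add_assoc l m n).symm⟩
    · exact translate_apply_of_notMem_range hkn _

/-- Convolution by `f ∈ ℓ²(ι)`, that is, `g ↦ ∑ n, g n • translate n f`. It is an isometry of
`ℓ²(ι)` because the translates of `f` are assumed to be orthonormal. -/
noncomputable def convolution {f : ℓ²(ι, 𝕜)} (hf : Orthonormal 𝕜 fun n => translate n f) :
    ℓ²(ι, 𝕜) →ₗᵢ[𝕜] ℓ²(ι, 𝕜) :=
  hf.orthogonalFamily.linearIsometry

theorem hasSum_convolution_apply {f : ℓ²(ι, 𝕜)}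
    (hf : Orthonormal 𝕜 fun n => translate n f) (g : ℓ²(ι, 𝕜)) (k : ι) :
    HasSum (fun p : {p : ι × ι // p.1 + p.2 = k} => g p.1.1 * f p.1.2) (convolution hf g k) := by
  have hsum : HasSum (fun n => g n * translate n f k) (convolution hf g k) :=
    (hf.orthogonalFamily.hasSum_linearIsometry g).mapL (lp.evalCLM 𝕜 (fun _ : ι => 𝕜) 2 k)
  have hinj : Function.Injective fun p : {p : ι × ι // p.1 + p.2 = k} => p.1.1 := by
    rintro ⟨⟨n, l⟩, hl⟩ ⟨⟨_, m⟩, hm⟩ rfl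
    simpa using hl.trans hm.symm
  have hzero : ∀ n ∉ range fun p : {p : ι × ι // p.1 + p.2 = k} => p.1.1,
      g n * translate n f k = 0 := by
    intro n hn
    rw [translate_apply_of_notMem_range, mul_zero]
    rintro ⟨l, hl⟩
    exact hn ⟨⟨(n, l), (add_comm n l).trans hl⟩, rfl⟩
  convert (hinj.hasSum_iff hzero).2 hsum using 2 with p
  obtain ⟨⟨n, l⟩, rfl⟩ := p
  simp [add_comm n l, translate_apply_add]

theorem convolution_comm {f g : ℓ²(ι, 𝕜)} (hf : Orthonormal 𝕜 fun n => translate n f)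
    (hg : Orthonormal 𝕜 fun n => translate n g) : convolution hf g = convolution hg f := by
  ext k
  let swap : {p : ι × ι // p.1 + p.2 = k} ≃ {p : ι × ι // p.1 + p.2 = k} :=
    (Equiv.prodComm ι ι).subtypeEquiv fun p => by simp [add_comm]
  refine (hasSum_convolution_apply hf g k).unique ?_
  simpa [swap, Function.comp_def, mul_comm] using
    swap.hasSum_iff.2 (hasSum_convolution_apply hg f k)

theorem orthonormal_translate_smul {f : ℓ²(ι, 𝕜)} (hf0 : f ≠ 0)
    (hf : Pairwise fun n m => ⟪translate n f, translate m f⟫_𝕜 = 0) :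
    Orthonormal 𝕜 fun n => translate n ((‖f‖⁻¹ : 𝕜) • f) := by
  refine ⟨fun n => ?_, fun n m hnm => ?_⟩
  · rw [LinearIsometry.norm_map, norm_smul_inv_norm hf0]
  · simp only [map_smul, inner_smul_left, inner_smul_right, hf hnm, mul_zero]

theorem exists_inner_translate_ne_zero {f g : ℓ²(ι, 𝕜)}
    (hf : Orthonormal 𝕜 fun n => translate n f) (hg : Orthonormal 𝕜 fun n => translate n g) :
    ∃ n m, ⟪translate n f, translate m g⟫_𝕜 ≠ 0 := by
  by_contra! horth
  have hinner_left (x : ℓ²(ι, 𝕜)) (m : ι) : ⟪translate m g, convolution hf x⟫_𝕜 = 0 := by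
    refine ((hf.orthogonalFamily.hasSum_linearIsometry x).mapL (innerSL 𝕜 _)).unique ?_
    convert hasSum_zero with n
    simp [inner_eq_zero_symm.1 (horth n m)]
  have hinner (x y : ℓ²(ι, 𝕜)) : ⟪convolution hf x, convolution hg y⟫_𝕜 = 0 := by
    refine ((hg.orthogonalFamily.hasSum_linearIsometry y).mapL (innerSL 𝕜 _)).unique ?_
    convert hasSum_zero with m
    simp [inner_eq_zero_symm.1 (hinner_left x m)]
  have hzero : convolution hf g = 0 := by
    rw [← inner_self_eq_zero (𝕜 := 𝕜)]
    nth_rw 2 [convolution_comm hf hg]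
    exact hinner g f
  have hg0 : g = 0 := (map_eq_zero_iff _ (LinearIsometry.injective _)).1 hzero
  simpa [hg0] using hg.1 0

theorem eq_zero_or_eq_zero_of_orthogonal_translates {f g : ℓ²(ι, 𝕜)}
    (hf : Pairwise fun n m => ⟪translate n f, translate m f⟫_𝕜 = 0)
    (hg : Pairwise fun n m => ⟪translate n g, translate m g⟫_𝕜 = 0)
    (hfg : ∀ n m, ⟪translate n f, translate m g⟫_𝕜 = 0) : f = 0 ∨ g = 0 := by
  by_contra! hne
  obtain ⟨n, m, hnm⟩ := exists_inner_translate_ne_zero (orthonormal_translate_smul hne.1 hf)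
    (orthonormal_translate_smul hne.2 hg)
  simp only [map_smul, inner_smul_left, inner_smul_right, hfg, mul_zero, ne_eq,
    not_true_eq_false] at hnm

end Translate

theorem laurent_monomial_mul (f : ℂ × ℂ → ℂ) {ρ t : ℝ} (hρ : ρ ≠ 0) (ht : t ≠ 0) (i j k l : ℤ) :
    laurent (fun p => p.1 ^ i * p.2 ^ j * f p) (k + i) (l + j) ρ t = laurent f k l ρ t := by
  unfold laurent torusMean
  congr 1
  refine intervalIntegral.integral_congr fun θ _ => intervalIntegral.integral_congr fun γ _ => ?_
  have hz : (ρ : ℂ) * Complex.exp (θ * Complex.I) ≠ 0 :=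
    mul_ne_zero (Complex.ofReal_ne_zero.2 hρ) (Complex.exp_ne_zero _)
  have hw : (t : ℂ) * Complex.exp (γ * Complex.I) ≠ 0 :=
    mul_ne_zero (Complex.ofReal_ne_zero.2 ht) (Complex.exp_ne_zero _)
  simp only
  generalize (ρ : ℂ) * Complex.exp (θ * Complex.I) = z at hz ⊢
  generalize (t : ℂ) * Complex.exp (γ * Complex.I) = w at hw ⊢
  rw [neg_add, neg_add, zpow_add₀ hz, zpow_add₀ hw, zpow_neg z i, zpow_neg w j]
  field_simp

namespace HardySpace

theorem coeffs_eq_translate {f h : HardySpace} {i j : ℕ}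
    (hh : ∀ p, h p = p.1 ^ i * p.2 ^ j * f p) : coeffs h = translate (i, i + j) (coeffs f) := by
  have hh_zpow : h.1 = fun p => p.1 ^ (i : ℤ) * p.2 ^ (j : ℤ) * f p := by
    ext p
    simpa only [zpow_natCast] using hh p
  have hlc (n : Fin 2 → ℤ) : lc h.1 n = lc f.1 ![n 0 - i, n 1 - j] := by
    have hmonomial := laurent_monomial_mul f.1 (ρ := 1 / 4) (t := 1 / 2) (by norm_num)
      (by norm_num) i j (n 0 - i) (n 1 - j)
    rwa [sub_add_cancel, sub_add_cancel, ← hh_zpow] at hmonomial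
  refine eq_translate (fun k => (hlc _).trans ?_) fun k hk => (hlc _).trans ?_
  · have hidx : ![idx (k + (i, i + j)) 0 - i, idx (k + (i, i + j)) 1 - j] = idx k := by
      ext a
      fin_cases a
      · simp [idx]
      · simp only [idx, Matrix.cons_val_zero, Matrix.cons_val_one, Fin.mk_one, Prod.fst_add,
          Prod.snd_add]
        push_cast
        ring
    rw [hidx]
    rfl
  · have hlt : k.1 < i ∨ k.2 < i + j := by
      by_contra! hle
      exact hk ⟨k - (i, i + j), tsub_add_cancel_of_le (Prod.mk_le_mk.2 hle)⟩
    refine lc_eq_zero f.2 _ ?_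
    simp only [idx, Matrix.cons_val_zero, Matrix.cons_val_one]
    lia

end HardySpace

namespace HardySubmodule

open HardySpace

variable (S : HardySubmodule)

theorem Sz_pow_Sw_pow_apply (i j : ℕ) (f : S.carrier) (p : ℂ × ℂ) :
    ((S.Sz ^ i) ((S.Sw ^ j) f)).1 p = p.1 ^ i * p.2 ^ j * f.1 p := by
  have hSw : ((S.Sw ^ j) f).1 p = p.2 ^ j * f.1 p := by
    induction j with
    | zero => simp
    | succ j ih =>
      rw [pow_succ', mul_apply_eq_comp, pow_succ', mul_assoc, ← ih]
      rfl
  induction i with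
  | zero => simpa using hSw
  | succ i ih =>
    rw [pow_succ', mul_apply_eq_comp, pow_succ', mul_assoc, mul_assoc, ← mul_assoc (p.1 ^ i), ← ih]
    rfl

theorem coeffs_Sz_pow_Sw_pow_apply (i j : ℕ) (f : S.carrier) :
    coeffs ((S.Sz ^ i) ((S.Sw ^ j) f)).1 = translate (i, i + j) (coeffs f.1) :=
  coeffs_eq_translate (S.Sz_pow_Sw_pow_apply i j f)

theorem coeffs_Sz_pow_apply (i : ℕ) (f : S.carrier) :
    coeffs ((S.Sz ^ i) f).1 = translate (i, i) (coeffs f.1) :=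
  S.coeffs_Sz_pow_Sw_pow_apply i 0 f

theorem coeffs_Sw_pow_apply (j : ℕ) (f : S.carrier) :
    coeffs ((S.Sw ^ j) f).1 = translate (0, j) (coeffs f.1) := by
  simpa using S.coeffs_Sz_pow_Sw_pow_apply 0 j f

theorem commute_Sz_Sw : Commute S.Sz S.Sw := by
  ext f
  exact Subtype.ext (funext fun p => mul_left_comm p.1 p.2 (f.1 p))

variable {S}

theorem coeffs_coe_eq_zero {f : S.carrier} : coeffs f.1 = 0 ↔ f = 0 :=
  (map_eq_zero_iff coeffs coeffs_injective).trans Submodule.coe_eq_zero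

theorem star_mul_self_eq_one_of_coeffs_eq {T : S.carrier →L[ℂ] S.carrier} {n : ℕ × ℕ}
    (hT : ∀ f : S.carrier, coeffs (T f).1 = translate n (coeffs f.1)) : star T * T = 1 := by
  refine T.norm_map_iff_adjoint_comp_self.1 fun f => ?_
  rw [Submodule.coe_norm, ← norm_coeffs, hT, LinearIsometry.norm_map, norm_coeffs,
    Submodule.coe_norm]

theorem doublyCommutingIsometries (hdc : S.DoublyCommuting) :
    DoublyCommutingIsometries S.Sz S.Sw where
  isometry_left := star_mul_self_eq_one_of_coeffs_eq fun f => S.coeffs_Sz_pow_apply 1 f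
  isometry_right := star_mul_self_eq_one_of_coeffs_eq fun f => S.coeffs_Sw_pow_apply 1 f
  commute := S.commute_Sz_Sw
  commute_star := sub_eq_zero.1 hdc

theorem isPure_of_coeffs_eq {T : S.carrier →L[ℂ] S.carrier} {m : ℕ → ℕ}
    (hT : ∀ (n : ℕ) (f : S.carrier), coeffs ((T ^ n) f).1 = translate (m n, n) (coeffs f.1)) :
    IsPure T := by
  intro f hf
  refine coeffs_coe_eq_zero.1 (lp.ext (funext fun k => ?_))
  obtain ⟨g, hg⟩ := hf (k.2 + 1)
  rw [← hg, hT, translate_apply_of_notMem_range]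
  · rfl
  · rintro ⟨l, hl⟩
    have hsnd : l.2 + (k.2 + 1) = k.2 := congrArg Prod.snd hl
    lia

theorem isPure_Sz (S : HardySubmodule) : IsPure S.Sz := isPure_of_coeffs_eq S.coeffs_Sz_pow_apply

theorem isPure_Sw (S : HardySubmodule) : IsPure S.Sw :=
  isPure_of_coeffs_eq (m := 0) S.coeffs_Sw_pow_apply

theorem inner_translate_coeffs_eq_zero (hdc : S.DoublyCommuting) {f g : S.carrier}
    (hf : f ∈ wanderingSubspace S.Sz S.Sw) (hg : g ∈ wanderingSubspace S.Sz S.Sw) {n m : ℕ × ℕ}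
    (hnm : n ≠ m) : ⟪translate n (coeffs f.1), translate m (coeffs g.1)⟫_ℂ = 0 := by
  -- Translation by `(a, b)` is multiplication by `(z / w) ^ a * w ^ b`; a common power of `w` turns
  -- both multipliers into monomials in `z` and `w`.
  have htranslate (n : ℕ × ℕ) (N : ℕ) (f : S.carrier) :
      translate (0, n.1 + N) (translate n (coeffs f.1)) =
        coeffs ((S.Sz ^ n.1) ((S.Sw ^ (n.2 + N)) f)).1 := by
    have hindex : n + (0, n.1 + N) = (n.1, n.1 + (n.2 + N)) :=
      Prod.ext (add_zero _) (add_left_comm _ _ _)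
    rw [coeffs_Sz_pow_Sw_pow_apply, translate_translate, hindex]
  have hne : (n.1, n.2 + m.1) ≠ (m.1, m.2 + n.1) := by
    rw [Ne, Prod.mk.injEq]
    rintro ⟨hfst, hsnd⟩
    exact hnm (Prod.ext hfst (by lia))
  rw [← (translate (0, n.1 + m.1)).inner_map_map, htranslate, add_comm n.1, htranslate]
  exact (coeffsₗᵢ.inner_map_map _ _).trans
    ((doublyCommutingIsometries hdc).inner_pow_pow_apply_eq_zero hf hg hne)

theorem exists_wanderingSubspace_le_span_singleton (hdc : S.DoublyCommuting) :
    ∃ g, wanderingSubspace S.Sz S.Sw ≤ ℂ ∙ g := by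
  refine exists_le_span_singleton_of_inner_eq_zero fun f hf g hg hfg => ?_
  have horth (n m : ℕ × ℕ) : ⟪translate n (coeffs f.1), translate m (coeffs g.1)⟫_ℂ = 0 := by
    obtain rfl | hnm := eq_or_ne n m
    · rw [LinearIsometry.inner_map_map]
      exact (coeffsₗᵢ.inner_map_map f.1 g.1).trans hfg
    · exact inner_translate_coeffs_eq_zero hdc hf hg hnm
  exact (eq_zero_or_eq_zero_of_orthogonal_translates
    (fun n m => inner_translate_coeffs_eq_zero hdc hf hf)
    (fun n m => inner_translate_coeffs_eq_zero hdc hg hg) horth).imp coeffs_coe_eq_zero.1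
      coeffs_coe_eq_zero.1

end HardySubmodule

end Hartogs

theorem corollary2p5 (S : Hartogs.HardySubmodule) (hS : S.carrier ≠ ⊥)
    (hdc : S.DoublyCommuting) :
    Hartogs.rank S.Sz S.Sw = 1 ∧ ∃ g : S.carrier, Hartogs.closedSpan S.Sz S.Sw {g} = ⊤ := by
  obtain ⟨g, hg⟩ := Hartogs.HardySubmodule.exists_wanderingSubspace_le_span_singleton hdc
  have hcyclic : Hartogs.closedSpan S.Sz S.Sw {g} = ⊤ :=
    (Hartogs.HardySubmodule.doublyCommutingIsometries hdc).closedSpan_eq_top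
      S.isPure_Sz S.isPure_Sw hg
  have : Nontrivial S.carrier := Submodule.nontrivial_iff_ne_bot.2 hS
  exact ⟨Hartogs.rank_eq_one hcyclic, g, hcyclic⟩
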